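/- For $a\in\mathbf C$ and $n\in\mathbf N_0=\{0,1,2,\dots\}$ let $(a)_n=\prod_{i=1}^{n}(a+i-1)$, and let ${}_2F_1(a,b;c;z)$ be the Gauss hypergeometric function, i.e. the sum of $\sum_{n\ge 0}\frac{(a)_n(b)_n}{(c)_n}\frac{z^n}{n!}$ for $|z|<1$ (and for all $z$ if the series terminates), continued analytically to $\mathbf C\setminus[1,\infty)$. Let $$P_n(z)={}_2F_1\left(-n,n+1;1;\tfrac{1-z}{2}\right)\qquad(n\in\mathbf N_0,\ z\in\mathbf C)$$ be the Legendre polynomials, $$P_\nu^\mu(z)=\frac{1}{\Gamma(1-\mu)}\left(\frac{z+1}{z-1}\right)^{\mu/2}{}_2F_1\left(-\nu,\nu+1;1-\mu;\tfrac{1-z}{2}\right)\qquad(z\in\mathbf C\setminus(-\infty,1])$$ the associated Legendre function of the first kind, and $$\mathrm P_\nu^\mu(y)=\frac{1}{\Gamma(1-\mu)}\left(\frac{1+y}{1-y}\right)^{\mu/2}{}_2F_1\left(-\nu,\nu+1;1-\mu;\tfrac{1-y}{2}\right)\qquad(y\in(-1,1))$$ the Ferrers function of the first kind, where $\mu\notin\{1,2,3,\dots\}$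 and powers take principal values. Let $\mathbf D=\{z\in\mathbf C:|z|<1\}$ and, with principal square roots, $$\mathrm R=\sqrt{1+\rho^2-2\rho x},\qquad \zeta_\pm=\frac{1\pm\rho}{\sqrt{1+\rho^2-2\rho x}}.$$ Let $m\in\mathbf N_0$ and $x\in[-1,1]$. If $\rho\in\mathbf D\setminus(-1,0]$, then $$\frac{1}{\mathrm R^{m+1}}P_m(\zeta_+)=\frac{(1-\rho)^{-m}}{\sqrt\rho}\sum_{n=0}^\infty(2n+1)\,(m+1)_{2n}\,P_{-m}^{-2n-1}\left(\frac{1+\rho}{1-\rho}\right)P_n(x),$$ and if $\rho\in(0,1)$, then $$\frac{1}{\mathrm R^{m+1}}P_m(\zeta_-)=\frac{(1+\rho)^{-m}}{\sqrt\rho}\sum_{n=0}^\infty(2n+1)\,(m+1)_{2n}\,\mathrm P_{-m}^{-2n-1}\left(\frac{1-\rho}{1+\rho}\right)P_n(x),$$ where both series converge absolutely. -/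

import Mathlib

/-- The Gauss hypergeometric function `F(a, b; c; z)`, for `c` not in `{0, -1, -2, …}` (principal
branch). It is the sum of the Gauss series if `|z| < 1` or if the series terminates
(`a` or `b` in `{0, -1, -2, …}`); otherwise it is the analytic continuation of that sum from the
unit disk to the cut plane `ℂ ∖ [1, ∞)`, which is unique. -/
noncomputable def gaussHyp (a b c z : ℂ) : ℂ :=
  open Classical in
  if ‖z‖ < 1 ∨ ∃ k : ℕ, a = -(k : ℂ) ∨ b = -(k : ℂ) then
    ordinaryHypergeometric a b c z
  else if h : ∃ f : ℂ → ℂ, AnalyticOnNhd ℂ f {w : ℂ | 1 - w ∈ Complex.slitPlane} ∧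
      ∀ w : ℂ, ‖w‖ < 1 → f w = ordinaryHypergeometric a b c w then
    h.choose z
  else 0

/-- The associated Legendre function of the first kind `P_ν^μ(z)`,
for `z ∈ ℂ ∖ (-∞, 1]` and `μ ∉ {1, 2, 3, …}`. -/
noncomputable def assocLegendreP (ν μ z : ℂ) : ℂ :=
  1 / Complex.Gamma (1 - μ) * ((z + 1) / (z - 1)) ^ (μ / 2) *
    gaussHyp (-ν) (ν + 1) (1 - μ) ((1 - z) / 2)

/-- The Ferrers function of the first kind `P_ν^μ(x)` (associated Legendre function on the cut),
for `x ∈ (-1, 1)` and `μ ∉ {1, 2, 3, …}`. -/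
noncomputable def ferrersP (ν μ : ℂ) (x : ℝ) : ℂ :=
  1 / Complex.Gamma (1 - μ) * ((1 + (x : ℂ)) / (1 - (x : ℂ))) ^ (μ / 2) *
    gaussHyp (-ν) (ν + 1) (1 - μ) ((1 - (x : ℂ)) / 2)

/-- The Legendre polynomial `P_n(z)`. -/
noncomputable def legendrePoly (n : ℕ) (z : ℂ) : ℂ :=
  gaussHyp (-(n : ℂ)) ((n : ℂ) + 1) 1 ((1 - z) / 2)

/-- The Pochhammer symbol (rising factorial) `(a)_n = a (a + 1) ⋯ (a + n - 1)`. -/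
noncomputable def pochhammerSymbol (a : ℂ) (n : ℕ) : ℂ :=
  ∏ i ∈ Finset.range n, (a + (i : ℂ))

/-- `R(ρ, x) = √(1 + ρ² - 2ρx)` (principal square root). -/
noncomputable def radR (ρ x : ℂ) : ℂ :=
  (1 + ρ ^ 2 - 2 * ρ * x) ^ (1 / 2 : ℂ)

/-- `ζ₊(ρ, x) = (1 + ρ) / R(ρ, x)`. -/
noncomputable def zetaPlus (ρ x : ℂ) : ℂ :=
  (1 + ρ) / radR ρ x

/-- `ζ₋(ρ, x) = (1 - ρ) / R(ρ, x)`. -/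
noncomputable def zetaMinus (ρ x : ℂ) : ℂ :=
  (1 - ρ) / radR ρ x

open Finset

/-! Write `f_m = R^{-(m+1)} P_m(ζ₊)` and `w = -ρ/(1-ρ)`. The Legendre functions in the series come
from `F(m, 1-m; 2n+2; w)`, a terminating series, so everything reduces to the expansion of `(1-ρ)^m
f_m` in `(2n+1) ρ^n F_{m,n}(w) P_n(x)` with polynomials `F_{m,n}` (`hasSum_expandedFun`). The proof
is a two-step induction on `m`. Bonnet's recursion at `ζ₊` gives `(m+2) R² f_{m+2} = (2m+3)(1+ρ)
f_{m+1} - (m+1) f_m`. On the series side, multiplication by `R² = 1 + ρ² - 2ρx` acts on coefficients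
through Bonnet's recursion in `n` (`hasSum_mul_legendrePoly_mul`), and the resulting coefficients
agree by a contiguous relation (`expansionFun_recurrence`). Since `R² ≠ 0`, it can be cancelled;
uniqueness of Legendre expansions is never needed. The case `m = 0` is the generating function of
the Legendre polynomials, and `m = 1` follows from it by the same multiplication by `R²`. The second
expansion is the first at `(-ρ, -x)`. -/

/-! ### Pochhammer symbols and coefficient identities -/

theorem pochhammerSymbol_succ (a : ℂ) (n : ℕ) :
    pochhammerSymbol a (n + 1) = pochhammerSymbol a n * (a + n) := by
  simp [pochhammerSymbol, prod_range_succ]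

theorem pochhammerSymbol_succ_left (a : ℂ) (n : ℕ) :
    pochhammerSymbol a (n + 1) = a * pochhammerSymbol (a + 1) n := by
  simp only [pochhammerSymbol, prod_range_succ']
  simp only [Nat.cast_zero, add_zero, Nat.cast_add, Nat.cast_one]
  rw [mul_comm]
  congr 1
  exact prod_congr rfl fun i _ => by ring

theorem ascPochhammer_eval_eq_pochhammerSymbol (a : ℂ) (n : ℕ) :
    (ascPochhammer ℂ n).eval a = pochhammerSymbol a n := by
  induction n with
  | zero => simp [pochhammerSymbol]
  | succ n ih => rw [ascPochhammer_succ_eval, ih, pochhammerSymbol_succ]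

theorem factorial_mul_pochhammerSymbol (r n : ℕ) :
    (r.factorial : ℂ) * pochhammerSymbol (r + 1) n = (r + n).factorial := by
  rw [← ascPochhammer_eval_eq_pochhammerSymbol, factorial_mul_ascPochhammer]

theorem pochhammerSymbol_neg_eq_zero {n k : ℕ} (h : n < k) :
    pochhammerSymbol (-(n : ℂ)) k = 0 :=
  prod_eq_zero (mem_range.2 h) (by simp)

/-- The product `(a)_k (1 - a)_k`. -/
noncomputable def pochReflect (a : ℂ) (k : ℕ) : ℂ :=
  pochhammerSymbol a k * pochhammerSymbol (1 - a) k

theorem pochReflect_natCast_eq_zero {m k : ℕ} (h : m < k) : pochReflect m k = 0 := by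
  rcases m with _ | m
  · rw [pochReflect, show ((0 : ℕ) : ℂ) = -((0 : ℕ) : ℂ) by simp,
      pochhammerSymbol_neg_eq_zero h, zero_mul]
  · rw [pochReflect, show (1 - ((m + 1 : ℕ) : ℂ)) = -(m : ℂ) by push_cast; ring,
      pochhammerSymbol_neg_eq_zero (by lia), mul_zero]

/-- The sequence `0, c 0, c 1, …`. -/
def shiftSeq (c : ℕ → ℂ) : ℕ → ℂ
  | 0 => 0
  | k + 1 => c k

/-- Turns relations with polynomial coefficients in `w` into identities between the coefficients of
`w ^ k`. -/
theorem HasSum.shiftSeq {c : ℕ → ℂ} {w s : ℂ} (h : HasSum (fun k => c k * w ^ k) s) :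
    HasSum (fun k => shiftSeq c k * w ^ k) (w * s) := by
  rw [← hasSum_nat_add_iff' 1]
  simp only [_root_.shiftSeq, sum_range_one, zero_mul, sub_zero]
  exact (h.mul_left w).congr_fun (fun k => by ring)

/-- Values of `(a - 1)_k (2 - a)_k`, `(a)_k (1 - a)_k`, `(a + 1)_k (-a)_k` through a common
factor. -/
theorem pochReflect_common_factor (a : ℂ) (i : ℕ) :
    ∃ X : ℂ,
      pochReflect (a - 1) (i + 4) =
        (a - 1) * a * X * ((2 - a + i) * (3 - a + i) * (4 - a + i) * (5 - a + i)) ∧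
      pochReflect a (i + 4) =
        a * X * (a + 3 + i) * (1 - a) * ((2 - a + i) * (3 - a + i) * (4 - a + i)) ∧
      pochReflect a (i + 3) = a * X * (1 - a) * ((2 - a + i) * (3 - a + i)) ∧
      pochReflect (a + 1) (i + 4) =
        X * (a + 3 + i) * (a + 4 + i) * (-a * (1 - a)) * ((2 - a + i) * (3 - a + i)) ∧
      pochReflect (a + 1) (i + 3) = X * (a + 3 + i) * (-a * (1 - a)) * (2 - a + i) ∧
      pochReflect (a + 1) (i + 2) = X * (-a * (1 - a)) := by
  have h1 (b : ℂ) (k : ℕ) : pochhammerSymbol b (k + 2) =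
      b * (b + 1) * pochhammerSymbol (b + 1 + 1) k := by
    rw [pochhammerSymbol_succ_left, pochhammerSymbol_succ_left]; ring
  refine ⟨pochhammerSymbol (a + 1) i * (a + 1 + i) * (a + 2 + i) * pochhammerSymbol (2 - a) i,
    ?_, ?_, ?_, ?_, ?_, ?_⟩
  · rw [pochReflect, h1, show 1 - (a - 1) = 2 - a by ring, show a - 1 + 1 + 1 = a + 1 by ring]
    simp only [pochhammerSymbol_succ]
    push_cast; ring
  · rw [pochReflect, pochhammerSymbol_succ_left a, pochhammerSymbol_succ_left (1 - a),
      show 1 - a + 1 = 2 - a by ring]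
    simp only [pochhammerSymbol_succ]
    push_cast; ring
  · rw [pochReflect, pochhammerSymbol_succ_left a, pochhammerSymbol_succ_left (1 - a),
      show 1 - a + 1 = 2 - a by ring]
    simp only [pochhammerSymbol_succ]
    push_cast; ring
  · rw [pochReflect, h1 (1 - (a + 1)), show 1 - (a + 1) + 1 + 1 = 2 - a by ring]
    simp only [pochhammerSymbol_succ]
    push_cast; ring
  · rw [pochReflect, h1 (1 - (a + 1)), show 1 - (a + 1) + 1 + 1 = 2 - a by ring]
    simp only [pochhammerSymbol_succ]
    push_cast; ring
  · rw [pochReflect, h1 (1 - (a + 1)), show 1 - (a + 1) + 1 + 1 = 2 - a by ring]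
    simp only [pochhammerSymbol_succ]
    push_cast; ring

theorem pochReflect_bonnet (a : ℂ) (k : ℕ) :
    a * pochReflect (a + 1) k = (2 * a - 1) *
      (pochReflect a k - 2 * k ^ 2 * shiftSeq (pochReflect a) k)
      - (a - 1) * pochReflect (a - 1) k := by
  match k with
  | 0 => simp [pochReflect, pochhammerSymbol, shiftSeq]; ring
  | 1 => simp [pochReflect, pochhammerSymbol, shiftSeq]; ring
  | 2 => simp [pochReflect, pochhammerSymbol, shiftSeq, prod_range_succ]; ring
  | 3 => simp [pochReflect, pochhammerSymbol, shiftSeq, prod_range_succ]; ring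
  -- Four is the threshold because two shifts leave `(-a)_{k-2}`, and splitting off `-a` and `1 - a`
  -- from it leaves `(2-a)_{k-4}`. Past it, dividing by the common factor leaves a polynomial
  -- identity.
  | i + 4 =>
    obtain ⟨X, h1, h2, h3, h4, -, -⟩ := pochReflect_common_factor a i
    simp only [shiftSeq, h1, h2, h3, h4]
    push_cast; ring

/-- The coefficient of `w ^ k` in `expansionFun_recurrence`, with `a = m + 1` and the common
factorials removed. -/
theorem pochReflect_contiguous (a n : ℂ) (k : ℕ) :
    (a + 1) * ((2 * n + 1) * ((a + 2 * n) * (a + 2 * n + 1)) *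
        (pochReflect (a + 1) k - 2 * ((2 * n + 1 + k) * k * shiftSeq (pochReflect (a + 1)) k) +
          2 * ((2 * n + 1 + k) * (2 * n + k) * k * (k - 1) *
            shiftSeq (shiftSeq (pochReflect (a + 1))) k))
      - 2 * n * ((2 * n + k) * (2 * n + 1 + k)) *
        (pochReflect (a + 1) k - 2 * ((2 * n - 1 + k) * k * shiftSeq (pochReflect (a + 1)) k) +
          (2 * n - 1 + k) * (2 * n - 2 + k) * k * (k - 1) *
            shiftSeq (shiftSeq (pochReflect (a + 1))) k)
      - 2 * (n + 1) * ((a + 2 * n) * (a + 2 * n + 1) * (a + 2 * n + 2) * (a + 2 * n + 3)) *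
        (k * (k - 1) * shiftSeq (shiftSeq (pochReflect (a + 1))) k)) =
    (2 * a + 1) * (2 * n + 1) * ((a + 2 * n) * (a + 1)) *
        (pochReflect a k - 2 * ((2 * n + 1 + k) * k * shiftSeq (pochReflect a) k))
      - a * (2 * n + 1) * (a * (a + 1)) * pochReflect (a - 1) k := by
  match k with
  | 0 => simp [pochReflect, pochhammerSymbol, shiftSeq]; ring
  | 1 => simp [pochReflect, pochhammerSymbol, shiftSeq]; ring
  | 2 => simp [pochReflect, pochhammerSymbol, shiftSeq, prod_range_succ]; ring
  | 3 => simp [pochReflect, pochhammerSymbol, shiftSeq, prod_range_succ]; ring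
  | i + 4 =>
    obtain ⟨X, h1, h2, h3, h4, h5, h6⟩ := pochReflect_common_factor a i
    simp only [shiftSeq, h1, h2, h3, h4, h5, h6]
    push_cast; ring

/-! ### Legendre polynomials: coefficients, Bonnet's recursion, parity -/

theorem hasSum_mul_pow_of_forall_lt {c : ℕ → ℂ} {N : ℕ} (h : ∀ k, N < k → c k = 0) (w : ℂ) :
    HasSum (fun k => c k * w ^ k) (∑' k, c k * w ^ k) :=
  (summable_of_ne_finset_zero (s := range (N + 1)) fun k hk => by
    rw [h k (by simpa using hk), zero_mul]).hasSum

theorem gaussHyp_eq_tsum_of_neg_nat {a b : ℂ} (c z : ℂ)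
    (h : ∃ k : ℕ, a = -(k : ℂ) ∨ b = -(k : ℂ)) :
    gaussHyp a b c z = ∑' k : ℕ, pochhammerSymbol a k * pochhammerSymbol b k /
      (k.factorial * pochhammerSymbol c k) * z ^ k := by
  rw [gaussHyp, if_pos (Or.inr h), ordinaryHypergeometric_eq_tsum]
  refine tsum_congr fun k => ?_
  simp only [ascPochhammer_eval_eq_pochhammerSymbol, smul_eq_mul]
  rw [div_eq_mul_inv, mul_inv]
  ring

noncomputable def legendreCoeff (n k : ℕ) : ℂ := pochReflect (n + 1) k / (k.factorial : ℂ) ^ 2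

theorem hasSum_legendrePoly (n : ℕ) (w : ℂ) :
    HasSum (fun k => legendreCoeff n k * w ^ k) (legendrePoly n (1 - 2 * w)) := by
  convert hasSum_mul_pow_of_forall_lt (c := legendreCoeff n) (N := n + 1) ?_ w using 1
  · rw [legendrePoly, gaussHyp_eq_tsum_of_neg_nat _ _ ⟨n, Or.inl rfl⟩]
    refine tsum_congr fun k => ?_
    have : pochhammerSymbol 1 k = k.factorial := by
      simpa using factorial_mul_pochhammerSymbol 0 k
    rw [legendreCoeff, pochReflect, this, show 1 - ((n : ℂ) + 1) = -n by ring,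
      show (1 - (1 - 2 * w)) / 2 = w by ring]
    ring
  · intro k hk
    have := pochReflect_natCast_eq_zero hk
    push_cast at this
    rw [legendreCoeff, this, zero_div]

theorem shiftSeq_legendreCoeff (n k : ℕ) :
    shiftSeq (legendreCoeff n) k =
      k ^ 2 * shiftSeq (pochReflect (n + 1)) k / (k.factorial : ℂ) ^ 2 := by
  cases k with
  | zero => simp [shiftSeq]
  | succ k =>
    have h1 : (k.factorial : ℂ) ≠ 0 := by exact_mod_cast k.factorial_ne_zero
    have h2 : (k : ℂ) + 1 ≠ 0 := by exact_mod_cast k.succ_ne_zero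
    simp only [shiftSeq, legendreCoeff, Nat.factorial_succ]
    push_cast
    field_simp

theorem legendrePoly_zero (z : ℂ) : legendrePoly 0 z = 1 := by
  have h := hasSum_legendrePoly 0 ((1 - z) / 2)
  rw [show 1 - 2 * ((1 - z) / 2) = z by ring] at h
  refine h.unique ?_
  convert hasSum_single 0 fun k hk => ?_ using 1
  · simp [legendreCoeff, pochReflect, pochhammerSymbol]
  · rcases k with _ | k
    · simp at hk
    · rw [legendreCoeff, pochReflect]
      rw [show (1 - (((0 : ℕ) : ℂ) + 1)) = -((0 : ℕ) : ℂ) by simp,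
        pochhammerSymbol_neg_eq_zero k.succ_pos]
      simp

/-- Bonnet's recursion for the Legendre polynomials. -/
theorem legendrePoly_bonnet (n : ℕ) (z : ℂ) :
    ((n : ℂ) + 1) * legendrePoly (n + 1) z =
      (2 * n + 1) * z * legendrePoly n z - n * legendrePoly (n - 1) z := by
  obtain ⟨w, rfl⟩ : ∃ w, z = 1 - 2 * w := ⟨(1 - z) / 2, by ring⟩
  have h0 := hasSum_legendrePoly n w
  have h1 := (hasSum_legendrePoly (n + 1) w).mul_left ((n : ℂ) + 1)
  have h2 := ((h0.sub (h0.shiftSeq.mul_left 2)).mul_left (2 * n + 1 : ℂ)).sub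
    ((hasSum_legendrePoly (n - 1) w).mul_left (n : ℂ))
  have : (fun k => ((n : ℂ) + 1) * (legendreCoeff (n + 1) k * w ^ k)) = fun k =>
      (2 * n + 1 : ℂ) * (legendreCoeff n k * w ^ k - 2 * (shiftSeq (legendreCoeff n) k * w ^ k)) -
        n * (legendreCoeff (n - 1) k * w ^ k) := by
    funext k
    -- The factor `n` makes the truncated index `n - 1` harmless at `n = 0`.
    have e : (n : ℂ) * legendreCoeff (n - 1) k = n * pochReflect n k / (k.factorial : ℂ) ^ 2 := by
      rcases n with _ | n
      · simp
      · simp [legendreCoeff]; ring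
    have := pochReflect_bonnet (n + 1) k
    rw [show (n : ℂ) + 1 - 1 = n by ring] at this
    rw [← mul_assoc (n : ℂ), e, shiftSeq_legendreCoeff, legendreCoeff, legendreCoeff]
    push_cast
    linear_combination w ^ k / (k.factorial : ℂ) ^ 2 * this
  rw [this] at h1
  rw [h1.unique h2]
  ring

theorem legendrePoly_one (z : ℂ) : legendrePoly 1 z = z := by
  simpa [legendrePoly_zero] using legendrePoly_bonnet 0 z

theorem legendrePoly_neg (n : ℕ) (z : ℂ) :
    legendrePoly n (-z) = (-1) ^ n * legendrePoly n z := by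
  induction n using Nat.strong_induction_on with
  | _ n ih =>
    match n with
    | 0 => simp [legendrePoly_zero]
    | 1 => simp [legendrePoly_one]
    | n + 2 =>
      have h1 := legendrePoly_bonnet (n + 1) (-z)
      have h2 := legendrePoly_bonnet (n + 1) z
      rw [Nat.add_sub_cancel, ih (n + 1) (by lia), ih n (by lia)] at h1
      rw [Nat.add_sub_cancel] at h2
      have h3 : ((n + 1 : ℕ) : ℂ) + 1 ≠ 0 := by exact_mod_cast (n + 1).succ_ne_zero
      refine mul_left_cancel₀ h3 ?_
      rw [pow_succ, pow_succ] at *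
      linear_combination h1 - (-1) ^ n * h2

/-! ### The expansion functions and their contiguous relation -/

/-- Coefficients of `(m + 2 n)! / (m! (2 n + 1)!) F(m, 1 - m; 2 n + 2; w)`. -/
noncomputable def expansionCoeff (m n k : ℕ) : ℂ :=
  ((m + 2 * n).factorial : ℂ) / m.factorial * pochReflect m k /
    ((2 * n + 1 + k).factorial * k.factorial)

noncomputable def expansionFun (m n : ℕ) (w : ℂ) : ℂ := ∑' k, expansionCoeff m n k * w ^ k

theorem expansionCoeff_eq_zero {m n k : ℕ} (h : m < k) : expansionCoeff m n k = 0 := by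
  simp [expansionCoeff, pochReflect_natCast_eq_zero h]

theorem hasSum_expansionFun (m n : ℕ) (w : ℂ) :
    HasSum (fun k => expansionCoeff m n k * w ^ k) (expansionFun m n w) :=
  hasSum_mul_pow_of_forall_lt (fun _ h => expansionCoeff_eq_zero h) w

/-- Brings the shifted coefficient over the same denominator as the unshifted one, so that only the
`pochReflect` parts have to be compared. -/
theorem shiftSeq_expansionCoeff (m n k : ℕ) :
    shiftSeq (expansionCoeff m n) k = ((m + 2 * n).factorial : ℂ) / m.factorial *
      ((2 * n + 1 + k) * k * shiftSeq (pochReflect m) k) /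
        ((2 * n + 1 + k).factorial * k.factorial) := by
  cases k with
  | zero => simp [shiftSeq]
  | succ k =>
    have h1 : (k.factorial : ℂ) ≠ 0 := by exact_mod_cast k.factorial_ne_zero
    have h2 : (k : ℂ) + 1 ≠ 0 := by exact_mod_cast k.succ_ne_zero
    have h3 : (m.factorial : ℂ) ≠ 0 := by exact_mod_cast m.factorial_ne_zero
    have h4 : ((2 * n + 1 + k).factorial : ℂ) ≠ 0 := by
      exact_mod_cast (2 * n + 1 + k).factorial_ne_zero
    have h5 : 2 * (n : ℂ) + 1 + (k + 1) ≠ 0 := by exact_mod_cast (2 * n + 1 + k).succ_ne_zero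
    simp only [shiftSeq, expansionCoeff, Nat.factorial_succ, ← add_assoc (2 * n + 1) k 1]
    push_cast
    rw [← add_assoc] at h5
    field_simp
    ring

theorem shiftSeq_shiftSeq_expansionCoeff (m n k : ℕ) :
    shiftSeq (shiftSeq (expansionCoeff m n)) k = ((m + 2 * n).factorial : ℂ) / m.factorial *
      ((2 * n + 1 + k) * (2 * n + k) * k * (k - 1) * shiftSeq (shiftSeq (pochReflect m)) k) /
        ((2 * n + 1 + k).factorial * k.factorial) := by
  cases k with
  | zero => simp [shiftSeq]
  | succ k =>
    have h1 : (k.factorial : ℂ) ≠ 0 := by exact_mod_cast k.factorial_ne_zero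
    have h2 : (k : ℂ) + 1 ≠ 0 := by exact_mod_cast k.succ_ne_zero
    have h3 : (m.factorial : ℂ) ≠ 0 := by exact_mod_cast m.factorial_ne_zero
    have h4 : ((2 * n + 1 + k).factorial : ℂ) ≠ 0 := by
      exact_mod_cast (2 * n + 1 + k).factorial_ne_zero
    have h5 : 2 * (n : ℂ) + 1 + (k + 1) ≠ 0 := by exact_mod_cast (2 * n + 1 + k).succ_ne_zero
    rw [show shiftSeq (shiftSeq (expansionCoeff m n)) (k + 1) = shiftSeq (expansionCoeff m n) k
        from rfl, show shiftSeq (shiftSeq (pochReflect m)) (k + 1) = shiftSeq (pochReflect m) k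
        from rfl, shiftSeq_expansionCoeff]
    simp only [Nat.factorial_succ, ← add_assoc (2 * n + 1) k 1]
    push_cast
    rw [← add_assoc] at h5
    field_simp
    ring

/-- Contiguous relation between the expansion functions. -/
theorem expansionFun_recurrence (m n : ℕ) (w : ℂ) :
    ((m : ℂ) + 2) * ((2 * n + 1) * (1 - 2 * w + 2 * w ^ 2) * expansionFun (m + 2) n w
      - 2 * n * (1 - w) ^ 2 * expansionFun (m + 2) (n - 1) w
      - 2 * (n + 1) * w ^ 2 * expansionFun (m + 2) (n + 1) w) =
    (2 * m + 3) * (2 * n + 1) * (1 - 2 * w) * expansionFun (m + 1) n w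
      - (m + 1) * (2 * n + 1) * expansionFun m n w := by
  have a := hasSum_expansionFun (m + 2) n w
  have b := hasSum_expansionFun (m + 2) (n - 1) w
  have c := hasSum_expansionFun (m + 2) (n + 1) w
  have d := hasSum_expansionFun (m + 1) n w
  have e := hasSum_expansionFun m n w
  -- The factors `1 - 2w + 2w²`, `(1 - w)²` and `w²` are expanded, each power of `w` becoming a
  -- shift; the coefficients of `w ^ k` are then compared.
  have h1 := ((((a.sub (a.shiftSeq.mul_left 2)).add (a.shiftSeq.shiftSeq.mul_left 2)).mul_left
    (2 * n + 1 : ℂ)).sub (((b.sub (b.shiftSeq.mul_left 2)).add b.shiftSeq.shiftSeq).mul_left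
    (2 * n : ℂ)) |>.sub (c.shiftSeq.shiftSeq.mul_left (2 * (n + 1) : ℂ))).mul_left ((m : ℂ) + 2)
  have h2 := ((d.sub (d.shiftSeq.mul_left 2)).mul_left ((2 * m + 3) * (2 * n + 1) : ℂ)).sub
    (e.mul_left ((m + 1) * (2 * n + 1) : ℂ))
  have key := h1.unique (h2.congr_fun fun k => ?_)
  · linear_combination key
  -- All the terms are multiples of `s * r`; what remains is `pochReflect_contiguous` at `a = m +
  -- 1`.
  set s : ℂ := (m + 2 * n).factorial / (m + 2).factorial with hs
  set r : ℂ := ((2 * n + 1 + k).factorial * k.factorial : ℂ)⁻¹ with hr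
  have hm : (m.factorial : ℂ) ≠ 0 := by exact_mod_cast m.factorial_ne_zero
  have hm2s : (m : ℂ) + 1 + 1 ≠ 0 := by exact_mod_cast (m + 1).succ_ne_zero
  have g2 : ((m + 2 + 2 * n).factorial : ℂ) / (m + 2).factorial =
      s * ((m + 1 + 2 * n) * (m + 2 + 2 * n)) := by
    rw [hs, show m + 2 + 2 * n = m + 2 * n + 1 + 1 by ring]
    simp only [Nat.factorial_succ]; push_cast; field_simp; ring
  have g1 : ((m + 1 + 2 * n).factorial : ℂ) / (m + 1).factorial =
      s * ((m + 1 + 2 * n) * (m + 2)) := by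
    rw [hs, show m + 1 + 2 * n = m + 2 * n + 1 by ring]
    simp only [Nat.factorial_succ]; push_cast; field_simp; ring
  have g0 : ((m + 2 * n).factorial : ℂ) / m.factorial = s * ((m + 1) * (m + 2)) := by
    rw [hs]
    simp only [Nat.factorial_succ]; push_cast; field_simp; ring
  have g3 : ((m + 2 + 2 * (n + 1)).factorial : ℂ) / (m + 2).factorial =
      s * ((m + 1 + 2 * n) * (m + 2 + 2 * n) * (m + 3 + 2 * n) * (m + 4 + 2 * n)) := by
    rw [hs, show m + 2 + 2 * (n + 1) = m + 2 * n + 1 + 1 + 1 + 1 by ring]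
    simp only [Nat.factorial_succ]; push_cast; field_simp; ring
  have hc : shiftSeq (shiftSeq (expansionCoeff (m + 2) (n + 1))) k =
      s * ((m + 1 + 2 * n) * (m + 2 + 2 * n) * (m + 3 + 2 * n) * (m + 4 + 2 * n)) *
        (k * (k - 1) * shiftSeq (shiftSeq (pochReflect (m + 2 : ℕ))) k) * r := by
    have : ((2 * (n + 1) + 1 + k).factorial : ℂ) ≠ 0 := by
      exact_mod_cast (2 * (n + 1) + 1 + k).factorial_ne_zero
    have h6 : ((2 * n + 1 + k).factorial : ℂ) ≠ 0 := by
      exact_mod_cast (2 * n + 1 + k).factorial_ne_zero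
    have h7 : 2 * (n : ℂ) + 1 + k + 1 ≠ 0 := by exact_mod_cast (2 * n + 1 + k).succ_ne_zero
    have h8 : 2 * (n : ℂ) + 1 + k + 1 + 1 ≠ 0 := by
      exact_mod_cast (2 * n + 1 + k + 1).succ_ne_zero
    rw [shiftSeq_shiftSeq_expansionCoeff, g3, hr,
      show 2 * (n + 1) + 1 + k = 2 * n + 1 + k + 1 + 1 by ring]
    simp only [Nat.factorial_succ]; push_cast; field_simp; ring
  have hb : ∀ Q : ℂ, 0 < n → s * Q / ((2 * (n - 1) + 1 + k : ℕ).factorial * k.factorial) =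
      s * ((2 * n + k) * (2 * n + 1 + k)) * Q * r := by
    intro Q hn
    obtain ⟨p, rfl⟩ : ∃ p, n = p + 1 := ⟨n - 1, by lia⟩
    have h6 : ((2 * p + 1 + k).factorial : ℂ) ≠ 0 := by
      exact_mod_cast (2 * p + 1 + k).factorial_ne_zero
    have h7 : 2 * (p : ℂ) + 1 + k + 1 ≠ 0 := by exact_mod_cast (2 * p + 1 + k).succ_ne_zero
    have h8 : 2 * (p : ℂ) + 1 + k + 1 + 1 ≠ 0 := by
      exact_mod_cast (2 * p + 1 + k + 1).succ_ne_zero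
    rw [hr, show 2 * (p + 1) + 1 + k = 2 * p + 1 + k + 1 + 1 by ring, Nat.add_sub_cancel]
    simp only [Nat.factorial_succ]; push_cast; field_simp; ring
  have hb' : (n : ℂ) * (expansionCoeff (m + 2) (n - 1) k
      - 2 * shiftSeq (expansionCoeff (m + 2) (n - 1)) k
      + shiftSeq (shiftSeq (expansionCoeff (m + 2) (n - 1))) k) =
      n * (s * ((2 * n + k) * (2 * n + 1 + k)) * (pochReflect (m + 2 : ℕ) k
        - 2 * ((2 * n - 1 + k) * k * shiftSeq (pochReflect (m + 2 : ℕ)) k)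
        + (2 * n - 1 + k) * (2 * n - 2 + k) * k * (k - 1) *
          shiftSeq (shiftSeq (pochReflect (m + 2 : ℕ))) k) * r) := by
    rcases Nat.eq_zero_or_pos n with rfl | hn
    · simp
    have h := fun Q => hb Q hn
    rw [shiftSeq_shiftSeq_expansionCoeff, shiftSeq_expansionCoeff, expansionCoeff,
      show m + 2 + 2 * (n - 1) = m + 2 * n by lia, ← hs]
    simp only [h]
    push_cast [Nat.cast_sub (Nat.one_le_iff_ne_zero.2 hn.ne')]
    ring
  have ha0 : expansionCoeff (m + 2) n k = s * ((m + 1 + 2 * n) * (m + 2 + 2 * n)) *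
      pochReflect (m + 2 : ℕ) k * r := by
    rw [expansionCoeff, g2, hr, div_eq_mul_inv]
  have hd0 : expansionCoeff (m + 1) n k = s * ((m + 1 + 2 * n) * (m + 2)) *
      pochReflect (m + 1 : ℕ) k * r := by
    rw [expansionCoeff, g1, hr, div_eq_mul_inv]
  have he0 : expansionCoeff m n k = s * ((m + 1) * (m + 2)) * pochReflect m k * r := by
    rw [expansionCoeff, g0, hr, div_eq_mul_inv]
  have ha1 := shiftSeq_expansionCoeff (m + 2) n k
  have ha2 := shiftSeq_shiftSeq_expansionCoeff (m + 2) n k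
  have hd1 := shiftSeq_expansionCoeff (m + 1) n k
  rw [g2, div_eq_mul_inv, ← hr] at ha1 ha2
  rw [g1, div_eq_mul_inv, ← hr] at hd1
  have main := pochReflect_contiguous (m + 1) n k
  rw [show (m : ℂ) + 1 - 1 = m by ring, show (m : ℂ) + 1 + 1 = (m + 2 : ℕ) by push_cast; ring,
    show (m : ℂ) + 1 = (m + 1 : ℕ) by push_cast; ring] at main
  rw [ha0, ha1, ha2, hc, hd0, hd1, he0]
  push_cast at *
  linear_combination s * r * w ^ k * main - 2 * (m + 2) * w ^ k * hb'

/-! ### The generating function of the Legendre polynomials -/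

/-- `1 - 2 ρ x + ρ²` has its zeros on the unit circle and is not a negative real for `|ρ| < 1`. -/
theorem quadratic_mem_slitPlane {x : ℝ} (hx : x ∈ Set.Icc (-1 : ℝ) 1) {ρ : ℂ} (hρ : ‖ρ‖ < 1) :
    1 + ρ ^ 2 - 2 * ρ * x ∈ Complex.slitPlane := by
  have hn : ρ.re ^ 2 + ρ.im ^ 2 < 1 := by
    have := Complex.sq_norm ρ
    rw [Complex.normSq_apply] at this
    nlinarith [norm_nonneg ρ]
  rw [Complex.mem_slitPlane_iff]
  by_contra! h
  obtain ⟨h1, h2⟩ := h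
  have e1 : (1 + ρ ^ 2 - 2 * ρ * x).re = 1 + (ρ.re ^ 2 - ρ.im ^ 2) - 2 * ρ.re * x := by
    simp [pow_two]
  have e2 : (1 + ρ ^ 2 - 2 * ρ * x).im = 2 * ρ.im * (ρ.re - x) := by
    simp [pow_two]; ring
  rw [e1] at h1
  rw [e2] at h2
  rcases mul_eq_zero.1 h2 with h | h
  · have h3 : ρ.im = 0 := by linarith
    rw [h3] at h1 hn
    nlinarith [hx.1, hx.2, sq_nonneg (ρ.re - x), sq_nonneg (ρ.re + 1), sq_nonneg (ρ.re - 1)]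
  · have h3 : x = ρ.re := by linarith
    rw [h3] at h1
    nlinarith

theorem hasDerivAt_quadratic (x z : ℂ) :
    HasDerivAt (fun z : ℂ => 1 + z ^ 2 - 2 * z * x) (2 * z - 2 * x) z :=
  HasDerivAt.congr_deriv (show HasDerivAt (fun z : ℂ => 1 + z ^ 2 - 2 * z * x) _ z from
    (((hasDerivAt_id z).pow 2).const_add 1).sub (((hasDerivAt_id z).const_mul 2).mul_const x))
    (by simp)

theorem hasDerivAt_inv_radR {x : ℝ} (hx : x ∈ Set.Icc (-1 : ℝ) 1) {ρ : ℂ} (hρ : ‖ρ‖ < 1) :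
    HasDerivAt (fun z : ℂ => (1 + z ^ 2 - 2 * z * x) ^ (-(1 / 2) : ℂ))
      ((x - ρ) * (1 + ρ ^ 2 - 2 * ρ * x) ^ (-(1 / 2) : ℂ) / (1 + ρ ^ 2 - 2 * ρ * x)) ρ := by
  have hs := quadratic_mem_slitPlane hx hρ
  convert (hasDerivAt_quadratic x ρ).cpow_const (c := (-(1 / 2) : ℂ)) hs using 1
  rw [Complex.cpow_sub _ _ (Complex.slitPlane_ne_zero hs), Complex.cpow_one]
  ring

/-- The differential equation of `(1 - 2 ρ x + ρ²) ^ (-1/2)`, differentiated `n` times. -/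
theorem iteratedDeriv_inv_radR {x : ℝ} (hx : x ∈ Set.Icc (-1 : ℝ) 1) (n : ℕ) {ρ : ℂ}
    (hρ : ‖ρ‖ < 1) :
    (1 + ρ ^ 2 - 2 * ρ * x) * iteratedDeriv (n + 2)
        (fun z : ℂ => (1 + z ^ 2 - 2 * z * x) ^ (-(1 / 2) : ℂ)) ρ +
      (2 * n + 3) * (ρ - x) * iteratedDeriv (n + 1)
        (fun z : ℂ => (1 + z ^ 2 - 2 * z * x) ^ (-(1 / 2) : ℂ)) ρ +
      (n + 1) ^ 2 * iteratedDeriv n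
        (fun z : ℂ => (1 + z ^ 2 - 2 * z * x) ^ (-(1 / 2) : ℂ)) ρ = 0 := by
  set f : ℂ → ℂ := fun z : ℂ => (1 + z ^ 2 - 2 * z * x) ^ (-(1 / 2) : ℂ) with hf
  have hball : ∀ z : ℂ, ‖z‖ < 1 → Metric.ball (0 : ℂ) 1 ∈ nhds z := fun z hz =>
    Metric.isOpen_ball.mem_nhds (by simpa using hz)
  have han : AnalyticOnNhd ℂ f (Metric.ball 0 1) := by
    refine DifferentiableOn.analyticOnNhd (fun z hz => ?_) Metric.isOpen_ball
    exact (hasDerivAt_inv_radR hx (by simpa using hz)).differentiableAt.differentiableWithinAt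
  have hd (k : ℕ) (z : ℂ) (hz : ‖z‖ < 1) :
      HasDerivAt (iteratedDeriv k f) (iteratedDeriv (k + 1) f z) z := by
    rw [iteratedDeriv_succ, iteratedDeriv_eq_iterate]
    exact ((han.iterated_deriv k) z (by simpa using hz)).differentiableAt.hasDerivAt
  have hl (z : ℂ) : HasDerivAt (fun z : ℂ => z - x) 1 z := (hasDerivAt_id z).sub_const _
  -- Allows an identity valid on the whole open disc to be differentiated; hence the induction keeps
  -- `ρ` general.
  have hzero {g : ℂ → ℂ} {g' z : ℂ} (hz : ‖z‖ < 1) (hg : ∀ z : ℂ, ‖z‖ < 1 → g z = 0)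
      (h : HasDerivAt g g' z) : g' = 0 := by
    refine h.unique ((hasDerivAt_const z (0 : ℂ)).congr_of_eventuallyEq ?_)
    filter_upwards [hball z hz] with y hy using hg y (by simpa using hy)
  induction n generalizing ρ with
  | zero =>
    have h0 (z : ℂ) (hz : ‖z‖ < 1) : (1 + z ^ 2 - 2 * z * x) * iteratedDeriv 1 f z +
        (z - x) * iteratedDeriv 0 f z = 0 := by
      rw [iteratedDeriv_one, iteratedDeriv_zero, (hasDerivAt_inv_radR hx hz).deriv]
      have := Complex.slitPlane_ne_zero (quadratic_mem_slitPlane hx hz)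
      change _ * ((x - z) * f z / _) + (z - x) * f z = 0
      generalize f z = y
      generalize 1 + z ^ 2 - 2 * z * (x : ℂ) = q at this ⊢
      field_simp
      ring
    have := hzero hρ h0 (((hasDerivAt_quadratic x ρ).mul (hd 1 ρ hρ)).add ((hl ρ).mul (hd 0 ρ hρ)))
    push_cast
    linear_combination this
  | succ n ih =>
    have := hzero hρ (fun z hz => ih hz) ((((hasDerivAt_quadratic x ρ).mul (hd (n + 2) ρ hρ)).add
      (((hl ρ).const_mul (2 * n + 3 : ℂ)).mul (hd (n + 1) ρ hρ))).add
      ((hd n ρ hρ).const_mul ((n + 1) ^ 2 : ℂ)))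
    push_cast
    linear_combination this

/-- The right side is holomorphic in the unit disc, so it equals its Taylor series at `0`. At `ρ =
0` the differentiated equation is Bonnet's recursion times `(n + 1) n!`, which identifies the Taylor
coefficients. -/
theorem hasSum_pow_mul_legendrePoly {x : ℝ} (hx : x ∈ Set.Icc (-1 : ℝ) 1) {ρ : ℂ}
    (hρ : ‖ρ‖ < 1) :
    HasSum (fun n => ρ ^ n * legendrePoly n x)
      ((1 + ρ ^ 2 - 2 * ρ * x) ^ (-(1 / 2) : ℂ)) := by
  set f : ℂ → ℂ := fun z : ℂ => (1 + z ^ 2 - 2 * z * x) ^ (-(1 / 2) : ℂ) with hf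
  have hdiff : DifferentiableOn ℂ f (Metric.ball 0 1) := fun z hz =>
    (hasDerivAt_inv_radR hx (by simpa using hz)).differentiableAt.differentiableWithinAt
  have h := Complex.hasSum_taylorSeries_on_ball (f := f) (c := 0) (r := 1) (z := ρ)
    (by simpa using hdiff) (by simpa using hρ)
  have hcoeff (n : ℕ) : iteratedDeriv n f 0 = n.factorial * legendrePoly n x := by
    induction n using Nat.strong_induction_on with
    | _ n ih =>
      match n with
      | 0 => simp [legendrePoly_zero, hf]
      | 1 =>
        rw [iteratedDeriv_one, (hasDerivAt_inv_radR hx (by simp)).deriv]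
        simp [legendrePoly_one]
      | n + 2 =>
        have h1 := iteratedDeriv_inv_radR hx n (ρ := 0) (by simp)
        rw [ih n (by lia), ih (n + 1) (by lia)] at h1
        have h2 := legendrePoly_bonnet (n + 1) x
        rw [Nat.add_sub_cancel] at h2
        simp only [Nat.factorial_succ] at *
        push_cast at *
        linear_combination h1 - (n + 1) * n.factorial * h2
  refine h.congr_fun fun n => ?_
  have : (n.factorial : ℂ) ≠ 0 := by exact_mod_cast n.factorial_ne_zero
  rw [hcoeff, sub_zero, smul_eq_mul, smul_eq_mul]
  field_simp

/-! ### Growth bounds and convergence -/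

/-- The terms of the convergent generating series at `ρ = r` are bounded. This weak bound replaces
`|P_n(x)| ≤ 1`. -/
theorem exists_norm_legendrePoly_mul_pow_le {x : ℝ} (hx : x ∈ Set.Icc (-1 : ℝ) 1) {r : ℝ}
    (h0 : 0 < r) (h1 : r < 1) : ∃ C : ℝ, ∀ n, ‖legendrePoly n x‖ * r ^ n ≤ C := by
  have h := (hasSum_pow_mul_legendrePoly hx (ρ := r)
    (by rw [Complex.norm_real]; simpa [abs_of_pos h0])).summable.tendsto_atTop_zero.norm
  obtain ⟨C, hC⟩ := h.bddAbove_range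
  refine ⟨C, fun n => ?_⟩
  have := hC ⟨n, rfl⟩
  simpa [abs_of_pos h0, mul_comm] using this

theorem exists_norm_expansionFun_le (m : ℕ) (w : ℂ) :
    ∃ C : ℝ, 0 ≤ C ∧ ∀ n : ℕ, ‖expansionFun m n w‖ ≤ C * ((n : ℝ) + 1) ^ m := by
  refine ⟨∑ k ∈ range (m + 1), (m + 2 : ℝ) ^ m * ‖pochReflect m k‖ * ‖w‖ ^ k, by positivity,
    fun n => ?_⟩
  rw [expansionFun, tsum_eq_sum (s := range (m + 1)) fun k hk => by
    rw [expansionCoeff_eq_zero (by simpa using hk), zero_mul], sum_mul]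
  refine (norm_sum_le _ _).trans (sum_le_sum fun k _ => ?_)
  -- Of the `m + 2n` factors, the last `m` are at most `2n + m ≤ (m + 2)(n + 1)`; the others form
  -- `(2n)!`.
  have hf : ((m + 2 * n).factorial : ℝ) ≤ (m + 2) ^ m * (n + 1) ^ m * (2 * n + 1 + k).factorial := by
    have h1 : (m + 2 * n).factorial ≤ (2 * n).factorial * (2 * n + m) ^ m := by
      rw [add_comm m, ← Nat.factorial_mul_ascFactorial]
      exact Nat.mul_le_mul_left _ (Nat.ascFactorial_le_pow_add _ _)
    have h2 : (2 * n + m) ^ m ≤ ((m + 2) * (n + 1)) ^ m := Nat.pow_le_pow_left (by nlinarith) _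
    have h3 : (2 * n).factorial ≤ (2 * n + 1 + k).factorial := Nat.factorial_le (by lia)
    rw [mul_pow] at h2
    have := h1.trans (Nat.mul_le_mul h3 h2)
    rw [mul_comm (2 * n + 1 + k).factorial] at this
    exact_mod_cast this
  have hA : (0 : ℝ) < (2 * n + 1 + k).factorial := by exact_mod_cast Nat.factorial_pos _
  have hB : (1 : ℝ) ≤ m.factorial := by exact_mod_cast Nat.factorial_pos _
  have hC : (1 : ℝ) ≤ k.factorial := by exact_mod_cast Nat.factorial_pos _
  have : ((m + 2 * n).factorial : ℝ) / m.factorial / ((2 * n + 1 + k).factorial * k.factorial) ≤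
      (m + 2) ^ m * (n + 1) ^ m := by
    rw [div_div, div_le_iff₀ (by positivity)]
    refine hf.trans (mul_le_mul_of_nonneg_left ?_ (by positivity))
    have := mul_le_mul hB hC zero_le_one (by positivity)
    nlinarith
  simp only [expansionCoeff, norm_mul, norm_div, norm_pow, Complex.norm_natCast]
  calc _ = ((m + 2 * n).factorial : ℝ) / m.factorial / ((2 * n + 1 + k).factorial * k.factorial) *
        (‖pochReflect m k‖ * ‖w‖ ^ k) := by ring
    _ ≤ (m + 2) ^ m * (n + 1) ^ m * (‖pochReflect m k‖ * ‖w‖ ^ k) := by gcongr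
    _ = _ := by ring

/-- Polynomial growth against a geometric factor. The freedom in `c` and `g` covers the series
itself and the two pieces with `P_{n+1}` and `P_{n-1}` produced by multiplication by `x`. -/
theorem summable_expansion {x : ℝ} (hx : x ∈ Set.Icc (-1 : ℝ) 1) {ρ : ℂ} (hρ : ‖ρ‖ < 1)
    (m : ℕ) (w : ℂ) (c : ℕ → ℂ) (hc : ∀ n : ℕ, ‖c n‖ ≤ 2 * n + 1) (g : ℕ → ℕ)
    (hg : ∀ n, g n ≤ n + 1) :
    Summable fun n => c n * (ρ ^ n * expansionFun m n w) * legendrePoly (g n) x := by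
  -- `s` replaces `‖ρ‖` so that the bound may be divided by it even when `ρ = 0`.
  obtain ⟨s, hs, hs1⟩ := exists_between hρ
  obtain ⟨r, hr, hr1⟩ := exists_between hs1
  have hs0 : 0 < s := (norm_nonneg ρ).trans_lt hs
  have hr0 : 0 < r := hs0.trans hr
  obtain ⟨C, hC⟩ := exists_norm_legendrePoly_mul_pow_le hx hr0 hr1
  obtain ⟨A, hA0, hA⟩ := exists_norm_expansionFun_le m w
  have hC0 : 0 ≤ C := le_trans (by positivity) (hC 0)
  have hq : ‖s / r‖ < 1 := by
    rw [Real.norm_of_nonneg (by positivity), div_lt_one hr0]; exact hr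
  have hsum := ((summable_nat_add_iff (f := fun n : ℕ => (n : ℝ) ^ (m + 1) * (s / r) ^ n) 1).2
    (summable_pow_mul_geometric_of_norm_lt_one (m + 1) hq)).mul_left (2 * A * C / s)
  refine Summable.of_norm_bounded hsum fun n => ?_
  have hP : ‖legendrePoly (g n) x‖ ≤ C / r ^ (n + 1) := by
    rw [le_div_iff₀ (by positivity)]
    exact (mul_le_mul_of_nonneg_left (pow_le_pow_of_le_one hr0.le hr1.le (hg n))
      (norm_nonneg _)).trans (hC _)
  have hn : (0 : ℝ) ≤ n := n.cast_nonneg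
  rw [norm_mul, norm_mul, norm_mul, norm_pow]
  calc _ ≤ (2 * (n + 1)) * (s ^ n * (A * (n + 1) ^ m)) * (C / r ^ (n + 1)) := by
        gcongr
        · linarith [hc n]
        · exact hA n
    _ = _ := by
      push_cast
      rw [div_pow, pow_succ s, pow_succ ((n : ℝ) + 1)]
      field_simp

/-! ### Multiplication by `x` and the induction on `m` -/

/-- Bonnet's recursion `(2n+1) x P_n = (n+1) P_{n+1} + n P_{n-1}`, applied termwise and reindexed;
the weight `2n + 1` is kept apart from `t` for this purpose. -/
theorem hasSum_mul_legendrePoly_mul {t : ℕ → ℂ} {A x : ℂ}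
    (h : HasSum (fun n : ℕ => (2 * n + 1) * t n * legendrePoly n x) A)
    (h1 : Summable fun n : ℕ => ((n : ℂ) + 1) * t n * legendrePoly (n + 1) x)
    (h2 : Summable fun n : ℕ => (n : ℂ) * t n * legendrePoly (n - 1) x) :
    HasSum (fun n : ℕ => (n * t (n - 1) + (n + 1) * t (n + 1)) * legendrePoly n x) (x * A) := by
  have e1 : HasSum (fun n : ℕ => (n : ℂ) * t (n - 1) * legendrePoly n x)
      (∑' n : ℕ, ((n : ℂ) + 1) * t n * legendrePoly (n + 1) x) := by
    rw [← hasSum_nat_add_iff' 1]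
    simpa using h1.hasSum
  have e2 : HasSum (fun n : ℕ => ((n : ℂ) + 1) * t (n + 1) * legendrePoly n x)
      (∑' n : ℕ, (n : ℂ) * t n * legendrePoly (n - 1) x) := by
    have := (hasSum_nat_add_iff' 1).2 h2.hasSum
    simpa using this
  have e3 := (h1.hasSum.add h2.hasSum).unique ((h.mul_left x).congr_fun fun n => by
    linear_combination t n * legendrePoly_bonnet n x)
  rw [← e3]
  exact (e1.add e2).congr_fun fun n => by ring

theorem radR_ne_zero {x : ℝ} (hx : x ∈ Set.Icc (-1 : ℝ) 1) {ρ : ℂ} (hρ : ‖ρ‖ < 1) :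
    radR ρ x ≠ 0 := by
  rw [radR, Complex.cpow_ne_zero_iff]
  exact Or.inl (Complex.slitPlane_ne_zero (quadratic_mem_slitPlane hx hρ))

theorem radR_sq (ρ x : ℂ) : radR ρ x ^ 2 = 1 + ρ ^ 2 - 2 * ρ * x := by
  rw [radR, ← Complex.cpow_nat_mul]
  simp

noncomputable def expandedFun (m : ℕ) (ρ x : ℂ) : ℂ :=
  1 / radR ρ x ^ (m + 1) * legendrePoly m (zetaPlus ρ x)

theorem expandedFun_recurrence (m : ℕ) {x : ℝ} (hx : x ∈ Set.Icc (-1 : ℝ) 1) {ρ : ℂ}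
    (hρ : ‖ρ‖ < 1) :
    ((m : ℂ) + 2) * (1 + ρ ^ 2 - 2 * ρ * x) * expandedFun (m + 2) ρ x =
      (2 * m + 3) * (1 + ρ) * expandedFun (m + 1) ρ x - (m + 1) * expandedFun m ρ x := by
  have h := legendrePoly_bonnet (m + 1) (zetaPlus ρ x)
  have hR := radR_ne_zero hx hρ
  rw [← radR_sq]
  rw [Nat.add_sub_cancel, zetaPlus] at h
  simp only [expandedFun, zetaPlus]
  push_cast at h
  generalize radR ρ x = R at *
  generalize legendrePoly (m + 1 + 1) _ = a at *
  generalize legendrePoly (m + 1) _ = b at *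
  generalize legendrePoly m _ = c at *
  have hS : R ^ (m + 1) ≠ 0 := pow_ne_zero _ hR
  rw [show m + 2 + 1 = m + 1 + 1 + 1 from rfl, pow_succ R (m + 1 + 1), pow_succ R (m + 1)]
  generalize R ^ (m + 1) = S at *
  field_simp at h ⊢
  linear_combination h

theorem expansionFun_zero (n : ℕ) (w : ℂ) : (2 * n + 1) * expansionFun 0 n w = 1 := by
  have h1 : ((2 * n).factorial : ℂ) ≠ 0 := by exact_mod_cast (2 * n).factorial_ne_zero
  have h2 : 2 * (n : ℂ) + 1 ≠ 0 := by exact_mod_cast (2 * n).succ_ne_zero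
  rw [expansionFun, tsum_eq_single 0 fun k hk => by
    rw [expansionCoeff_eq_zero (Nat.pos_of_ne_zero hk), zero_mul]]
  simp [expansionCoeff, pochReflect, pochhammerSymbol, Nat.factorial_succ]
  field_simp

theorem expansionFun_one (n : ℕ) (w : ℂ) : expansionFun 1 n w = 1 := by
  have h1 : ((2 * n + 1).factorial : ℂ) ≠ 0 := by exact_mod_cast (2 * n + 1).factorial_ne_zero
  rw [expansionFun, tsum_eq_single 0 fun k hk => ?_]
  · simp [expansionCoeff, pochReflect, pochhammerSymbol, add_comm 1, h1]
  · obtain ⟨j, rfl⟩ := Nat.exists_eq_succ_of_ne_zero hk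
    simp [expansionCoeff, pochReflect, pochhammerSymbol_succ_left]

theorem hasSum_expandedFun (m : ℕ) {x : ℝ} (hx : x ∈ Set.Icc (-1 : ℝ) 1) {ρ : ℂ}
    (hρ : ‖ρ‖ < 1) :
    HasSum (fun n : ℕ => (2 * n + 1) * (ρ ^ n * expansionFun m n (-ρ / (1 - ρ))) *
      legendrePoly n x) ((1 - ρ) ^ m * expandedFun m ρ x) := by
  set w := -ρ / (1 - ρ) with hw
  have hρ1 : 1 - ρ ≠ 0 := by
    intro h
    rw [← sub_eq_zero.1 h, norm_one] at hρ
    exact lt_irrefl _ hρ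
  have hQ := Complex.slitPlane_ne_zero (quadratic_mem_slitPlane hx hρ)
  have hR := radR_ne_zero hx hρ
  have norm_two (n : ℕ) : ‖(2 * n + 1 : ℂ)‖ ≤ 2 * n + 1 := by
    simpa using norm_add_le (2 * n : ℂ) 1
  have norm_one' (n : ℕ) : ‖(n + 1 : ℂ)‖ ≤ 2 * n + 1 := by
    have : ‖(n + 1 : ℂ)‖ ≤ n + 1 := by simpa using norm_add_le (n : ℂ) 1
    linarith [(n.cast_nonneg : (0 : ℝ) ≤ n)]
  have norm_zero' (n : ℕ) : ‖(n : ℂ)‖ ≤ 2 * n + 1 := by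
    rw [Complex.norm_natCast]
    linarith [(n.cast_nonneg : (0 : ℝ) ≤ n)]
  have hpow (n : ℕ) : ρ * (n * ρ ^ (n - 1)) = n * ρ ^ n := by
    rcases n with _ | n
    · simp
    · rw [Nat.add_sub_cancel, pow_succ]; ring
  have hs' (m : ℕ) : ∃ T, HasSum (fun n : ℕ => (2 * n + 1) * (ρ ^ n * expansionFun m n w) *
      legendrePoly n x) T :=
    ⟨_, (summable_expansion hx hρ m w _ norm_two id fun n => n.le_succ).hasSum⟩
  -- `T m` is the sum of the series, so far unidentified; the induction shows that it is `(1 - ρ) ^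
  -- m * expandedFun m ρ x`.
  choose T hs using hs'
  have hmul (m : ℕ) := hasSum_mul_legendrePoly_mul (hs m)
    (summable_expansion hx hρ m w _ norm_one' (· + 1) fun n => le_rfl)
    (summable_expansion hx hρ m w _ norm_zero' (· - 1) fun n => show n - 1 ≤ n + 1 by lia)
  have h0 : HasSum (fun n : ℕ => (2 * n + 1) * (ρ ^ n * expansionFun 0 n w) *
      legendrePoly n x) ((1 - ρ) ^ 0 * expandedFun 0 ρ x) := by
    have := hasSum_pow_mul_legendrePoly hx hρ
    rw [Complex.cpow_neg] at this
    simp only [expandedFun, legendrePoly_zero, radR]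
    rw [pow_zero, one_mul, mul_one, zero_add, pow_one, one_div]
    exact this.congr_fun fun n => by
      linear_combination ρ ^ n * legendrePoly n x * expansionFun_zero n w
  have h1 : HasSum (fun n : ℕ => (2 * n + 1) * (ρ ^ n * expansionFun 1 n w) *
      legendrePoly n x) ((1 - ρ) ^ 1 * expandedFun 1 ρ x) := by
    -- As `F_{1,n} = 1`, the coefficients of `R² T 1` telescope to `(1 - ρ²) ρ^n`, hence `R² T 1 =
    -- (1 - ρ²) / R`.
    have key := (((hs 1).mul_left (1 + ρ ^ 2)).sub ((hmul 1).mul_left (2 * ρ))).unique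
      ((h0.mul_left (1 - ρ ^ 2)).congr_fun fun n => by
        have e0 := expansionFun_zero n w
        simp only [expansionFun_one]
        linear_combination -(1 - ρ ^ 2) * ρ ^ n * legendrePoly n x * e0 -
          2 * legendrePoly n x * hpow n)
    suffices h : (1 - ρ) ^ 1 * expandedFun 1 ρ x = T 1 from h ▸ hs 1
    refine mul_left_cancel₀ hQ ?_
    simp only [expandedFun, legendrePoly_zero, legendrePoly_one, zetaPlus] at key ⊢
    rw [← radR_sq]
    have e : radR ρ x ^ 2 * T 1 = (1 - ρ ^ 2) / radR ρ x := by
      rw [radR_sq]; linear_combination key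
    rw [e]
    field_simp
    ring
  induction m using Nat.twoStepInduction with
  | zero => exact h0
  | one => exact h1
  | more m ih0 ih1 =>
    -- Two expansions of `(m + 2) R² T (m + 2)`: by multiplication by `x`, and by the contiguous
    -- relation at `w`, cleared of `(1 - ρ)²`, with the induction hypotheses.
    have key := ((((hs (m + 2)).mul_left (1 + ρ ^ 2)).sub
      ((hmul (m + 2)).mul_left (2 * ρ))).mul_left (m + 2 : ℂ)).unique
      (((ih1.mul_left ((2 * m + 3) * (1 - ρ ^ 2) : ℂ)).sub
        (ih0.mul_left ((m + 1) * (1 - ρ) ^ 2 : ℂ))).congr_fun fun n => by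
        have r := expansionFun_recurrence m n w
        have w1 : 1 - w = 1 / (1 - ρ) := by rw [hw]; field_simp; ring
        have w2 : 1 - 2 * w = (1 - ρ ^ 2) / (1 - ρ) ^ 2 := by rw [hw]; field_simp; ring
        have w3 : w ^ 2 = ρ ^ 2 / (1 - ρ) ^ 2 := by rw [hw]; field_simp
        have w4 : 1 - 2 * w + 2 * w ^ 2 = (1 + ρ ^ 2) / (1 - ρ) ^ 2 := by
          rw [w2, w3]; field_simp; ring
        rw [w4, w1, w2, w3] at r
        field_simp at r
        linear_combination ρ ^ n * legendrePoly n x * r - 2 * (m + 2) *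
          expansionFun (m + 2) (n - 1) w * legendrePoly n x * hpow n)
    suffices h : (1 - ρ) ^ (m + 2) * expandedFun (m + 2) ρ x = T (m + 2) from h ▸ hs (m + 2)
    have hm : (m : ℂ) + 2 ≠ 0 := by exact_mod_cast (m + 1).succ_ne_zero
    refine mul_left_cancel₀ (mul_ne_zero hm hQ) ?_
    have := expandedFun_recurrence m hx hρ
    linear_combination (1 - ρ) ^ (m + 2) * this - key

/-! ### Return to Legendre and Ferrers functions -/

/-- The parameters are `m` and `1 - m`, one of which is a nonpositive integer, so the series
terminates for every `w` and no continuation enters. The factorials match through `(m+1)_{2n} =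
(m+2n)!/m!` and `Γ(2n+2) = (2n+1)!`. -/
theorem mul_gaussHyp_eq_expansionFun (m n : ℕ) (w : ℂ) :
    pochhammerSymbol ((m : ℂ) + 1) (2 * n) * (1 / Complex.Gamma (1 - (-2 * (n : ℂ) - 1)) *
      gaussHyp (-(-(m : ℂ))) (-(m : ℂ) + 1) (1 - (-2 * (n : ℂ) - 1)) w) =
    expansionFun m n w := by
  have ht : ∃ k : ℕ, -(-(m : ℂ)) = -(k : ℂ) ∨ -(m : ℂ) + 1 = -(k : ℂ) := by
    rcases m with _ | m
    · exact ⟨0, Or.inl (by simp)⟩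
    · exact ⟨m, Or.inr (by push_cast; ring)⟩
  rw [gaussHyp_eq_tsum_of_neg_nat _ _ ht, expansionFun, ← tsum_mul_left, ← tsum_mul_left]
  refine tsum_congr fun k => ?_
  have hc : 1 - (-2 * (n : ℂ) - 1) = ((2 * n + 1 : ℕ) : ℂ) + 1 := by push_cast; ring
  rw [hc, Complex.Gamma_nat_eq_factorial, expansionCoeff, pochReflect, neg_neg,
    ← factorial_mul_pochhammerSymbol m, ← factorial_mul_pochhammerSymbol (2 * n + 1) k,
    show -(m : ℂ) + 1 = 1 - m by ring]
  have hm : (m.factorial : ℂ) ≠ 0 := by exact_mod_cast m.factorial_ne_zero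
  rw [mul_div_cancel_left₀ _ hm]
  simp only [div_eq_mul_inv, mul_inv]
  ring

theorem inv_cpow_half (n : ℕ) {ρ : ℂ} (hρ : ρ ∈ Complex.slitPlane) :
    (1 / ρ) ^ ((-2 * (n : ℂ) - 1) / 2) = ρ ^ n * ρ ^ (1 / 2 : ℂ) := by
  rw [one_div, Complex.inv_cpow _ _ (Complex.slitPlane_arg_ne_pi hρ), ← Complex.cpow_neg,
    show -((-2 * (n : ℂ) - 1) / 2) = n + 1 / 2 by ring,
    Complex.cpow_add _ _ (Complex.slitPlane_ne_zero hρ), Complex.cpow_natCast]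

theorem mainTheorem10 (m : ℕ) (x : ℝ) (hx : x ∈ Set.Icc (-1 : ℝ) 1) :
    (∀ ρ : ℂ, ρ ∈ Metric.ball (0 : ℂ) 1 \ ((fun t : ℝ => (t : ℂ)) '' Set.Ioc (-1 : ℝ) 0) →
      Summable (fun n : ℕ => (2 * (n : ℂ) + 1) * pochhammerSymbol ((m : ℂ) + 1) (2 * n) *
        assocLegendreP (-(m : ℂ)) (-2 * (n : ℂ) - 1) ((1 + ρ) / (1 - ρ)) *
        legendrePoly n (x : ℂ)) ∧
      1 / radR ρ (x : ℂ) ^ (m + 1) * legendrePoly m (zetaPlus ρ (x : ℂ)) =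
        1 / (1 - ρ) ^ m / ρ ^ (1 / 2 : ℂ) *
          ∑' n : ℕ, (2 * (n : ℂ) + 1) * pochhammerSymbol ((m : ℂ) + 1) (2 * n) *
            assocLegendreP (-(m : ℂ)) (-2 * (n : ℂ) - 1) ((1 + ρ) / (1 - ρ)) *
            legendrePoly n (x : ℂ)) ∧
    (∀ ρ : ℝ, ρ ∈ Set.Ioo (0 : ℝ) 1 →
      Summable (fun n : ℕ => (2 * (n : ℂ) + 1) * pochhammerSymbol ((m : ℂ) + 1) (2 * n) *
        ferrersP (-(m : ℂ)) (-2 * (n : ℂ) - 1) ((1 - ρ) / (1 + ρ)) *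
        legendrePoly n (x : ℂ)) ∧
      1 / radR (ρ : ℂ) (x : ℂ) ^ (m + 1) * legendrePoly m (zetaMinus (ρ : ℂ) (x : ℂ)) =
        1 / (1 + (ρ : ℂ)) ^ m / (ρ : ℂ) ^ (1 / 2 : ℂ) *
          ∑' n : ℕ, (2 * (n : ℂ) + 1) * pochhammerSymbol ((m : ℂ) + 1) (2 * n) *
            ferrersP (-(m : ℂ)) (-2 * (n : ℂ) - 1) ((1 - ρ) / (1 + ρ)) *
            legendrePoly n (x : ℂ)) := by
  constructor
  · rintro ρ ⟨hb, hni⟩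
    have hρ : ‖ρ‖ < 1 := by simpa using hb
    have hsl : ρ ∈ Complex.slitPlane := by
      rw [Complex.mem_slitPlane_iff]
      by_contra! h
      -- Within the unit disc, the points off the slit plane are exactly the excluded segment `(-1,
      -- 0]`.
      refine hni ⟨ρ.re, ⟨?_, h.1⟩, Complex.ext (by simp) (by simp [h.2])⟩
      linarith [neg_abs_le ρ.re, Complex.abs_re_le_norm ρ]
    have h0 : ρ ≠ 0 := Complex.slitPlane_ne_zero hsl
    have h1 : 1 - ρ ≠ 0 := by
      intro h
      rw [← sub_eq_zero.1 h, norm_one] at hρ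
      exact lt_irrefl _ hρ
    have hsq : ρ ^ (1 / 2 : ℂ) ≠ 0 := by simp [h0]
    have hz1 : ((1 + ρ) / (1 - ρ) + 1) / ((1 + ρ) / (1 - ρ) - 1) = 1 / ρ := by
      have e1 : (1 + ρ) / (1 - ρ) + 1 = 2 / (1 - ρ) := by field_simp; ring
      have e2 : (1 + ρ) / (1 - ρ) - 1 = 2 * ρ / (1 - ρ) := by field_simp; ring
      rw [e1, e2]
      field_simp
    have hz2 : (1 - (1 + ρ) / (1 - ρ)) / 2 = -ρ / (1 - ρ) := by field_simp; ring
    have key := ((hasSum_expandedFun m hx hρ).mul_left (ρ ^ (1 / 2 : ℂ))).congr_fun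
      (g := fun n : ℕ => (2 * (n : ℂ) + 1) * pochhammerSymbol ((m : ℂ) + 1) (2 * n) *
        assocLegendreP (-(m : ℂ)) (-2 * (n : ℂ) - 1) ((1 + ρ) / (1 - ρ)) *
        legendrePoly n (x : ℂ)) fun n => by
        rw [assocLegendreP, hz1, hz2, inv_cpow_half n hsl, ← mul_gaussHyp_eq_expansionFun]
        ring
    refine ⟨key.summable, ?_⟩
    rw [key.tsum_eq, ← expandedFun]
    field_simp
  · rintro ρ ⟨hpos, hlt⟩
    have hx' : -x ∈ Set.Icc (-1 : ℝ) 1 := ⟨by linarith [hx.2], by linarith [hx.1]⟩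
    have hρ : ‖(-ρ : ℂ)‖ < 1 := by simpa [abs_of_pos hpos] using hlt
    have hsl : (ρ : ℂ) ∈ Complex.slitPlane := by simpa using hpos
    have h0 : (ρ : ℂ) ≠ 0 := Complex.slitPlane_ne_zero hsl
    have h1 : 1 + (ρ : ℂ) ≠ 0 := by
      have : 1 + ρ ≠ 0 := by positivity
      exact_mod_cast this
    have hsq : (ρ : ℂ) ^ (1 / 2 : ℂ) ≠ 0 := by simp [h0]
    have hz1 : (1 + (((1 - ρ) / (1 + ρ) : ℝ) : ℂ)) / (1 - (((1 - ρ) / (1 + ρ) : ℝ) : ℂ)) =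
        1 / ρ := by
      push_cast
      have e1 : 1 + (1 - (ρ : ℂ)) / (1 + ρ) = 2 / (1 + ρ) := by field_simp; ring
      have e2 : 1 - (1 - (ρ : ℂ)) / (1 + ρ) = 2 * ρ / (1 + ρ) := by field_simp; ring
      rw [e1, e2]
      field_simp
    have hz2 : (1 - (((1 - ρ) / (1 + ρ) : ℝ) : ℂ)) / 2 = -(-ρ) / (1 - -ρ) := by
      push_cast
      rw [sub_neg_eq_add]
      field_simp
      ring
    have key := ((hasSum_expandedFun m hx' hρ).mul_left ((ρ : ℂ) ^ (1 / 2 : ℂ))).congr_fun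
      (g := fun n : ℕ => (2 * (n : ℂ) + 1) * pochhammerSymbol ((m : ℂ) + 1) (2 * n) *
        ferrersP (-(m : ℂ)) (-2 * (n : ℂ) - 1) ((1 - ρ) / (1 + ρ)) *
        legendrePoly n (x : ℂ)) fun n => by
        rw [ferrersP, hz1, hz2, inv_cpow_half n hsl, ← mul_gaussHyp_eq_expansionFun,
          Complex.ofReal_neg, legendrePoly_neg, neg_pow (ρ : ℂ)]
        -- The signs from `(-ρ) ^ n` and from the parity of `P_n` cancel.
        have : ((-1 : ℂ) ^ n) * (-1) ^ n = 1 := by rw [← mul_pow]; simp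
        generalize gaussHyp _ _ _ _ = G
        linear_combination -(ρ : ℂ) ^ (1 / 2 : ℂ) * (2 * n + 1) * ρ ^ n *
          (pochhammerSymbol ((m : ℂ) + 1) (2 * n) *
            (1 / Complex.Gamma (1 - (-2 * (n : ℂ) - 1)) * G)) * legendrePoly n x * this
    refine ⟨key.summable, ?_⟩
    have e : expandedFun m (-ρ) (-x : ℝ) =
        1 / radR (ρ : ℂ) (x : ℂ) ^ (m + 1) * legendrePoly m (zetaMinus (ρ : ℂ) (x : ℂ)) := by
      have hR : radR (-ρ : ℂ) (-x : ℝ) = radR ρ x := by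
        rw [radR, radR]
        congr 1
        push_cast
        ring
      rw [expandedFun, zetaPlus, hR, zetaMinus, ← sub_eq_add_neg]
    rw [key.tsum_eq, e, sub_neg_eq_add]
    field_simp
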